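/- For an $n\times n$ upper-triangular matrix $A=(a_{i,j})$ with non-negative integer entries, define its hook sums by $$h_k=(a_{k,k}+a_{k,k+1}+\cdots+a_{k,n})-(a_{1,k}+\cdots+a_{k-1,k}),\qquad 1\le k\le n.$$ Let $\mathcal T(1^n)$ be the (finite) set of Tesler matrices of size $n$, i.e. those $A$ with $h_k=1$ for all $k$, and let $T(1^n)=|\mathcal T(1^n)|$. The Tesler poset $P(1^n)$ is the set $\mathcal T(1^n)$ with the partial order generated by the following cover relation: $A=(a_{i,j})$ covers $B=(b_{i,j})$ if either there are $i<j<k$ with $a_{i,j}=b_{i,j}+1$, $a_{j,k}=b_{j,k}+1$, $a_{i,k}=b_{i,k}-1$, or there are $i<j$ with $a_{i,j}=b_{i,j}+1$, $a_{j,j}=b_{j,j}+1$, $a_{i,i}=b_{i,i}-1$, all other entries of $A$ and $B$ being equal. Its least element $\hat 0$ is the identity matrix. Let $\mu$ be the Möbius function of $P(1^n)$. **Proposition.** Let $f$ be a real-valued function on $\mathbb N$ and let $n\in\mathbb N$. If $|\mu(\hat 0,A)|\le f(n)$ for all $A\in\mathcal T(1^n)$, then $$T(1^n)\ \ge\ \frac{2^{\binom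 n2}}{f(n)}.$$ -/

import Mathlib

/-- The `k`-th hook sum of a square matrix `A` of natural numbers:
`(a_{k,k} + a_{k,k+1} + ⋯ + a_{k,n}) - (a_{1,k} + ⋯ + a_{k-1,k})`, as an integer. -/
def hookSum {n : ℕ} (A : Matrix (Fin n) (Fin n) ℕ) (k : Fin n) : ℤ :=
  (∑ j ∈ Finset.Ici k, (A k j : ℤ)) - ∑ i ∈ Finset.Iio k, (A i k : ℤ)

/-- The set of generalized Tesler matrices with hook sum vector `α`: upper triangular matrices
with entries in `ℕ` whose `k`-th hook sum is `α k` for every `k`. -/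
def teslerMatrices {n : ℕ} (α : Fin n → ℕ) : Set (Matrix (Fin n) (Fin n) ℕ) :=
  {A | (∀ i j, j < i → A i j = 0) ∧ ∀ k, hookSum A k = (α k : ℤ)}

/-- The number of generalized Tesler matrices with hook sum vector `α`. -/
noncomputable def teslerNumber {n : ℕ} (α : Fin n → ℕ) : ℕ := (teslerMatrices α).ncard

/-- The underlying type of the Tesler poset with hook sum vector `α`. -/
def TeslerPoset {n : ℕ} (α : Fin n → ℕ) : Type := teslerMatrices α

/-- The cover relation of the Tesler poset, `TeslerCover B A` meaning that `A` covers `B`.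
Either, for some `i < j < k`, the matrix `A` arises from `B` by adding `1` to the entries `(i,j)`
and `(j,k)` and subtracting `1` from the entry `(i,k)`; or, for some `i < j`, it arises by adding
`1` to the entries `(i,j)` and `(j,j)` and subtracting `1` from the entry `(i,i)`. (The subtracted
unit is written on the other side of the equation, to stay within `ℕ`.) -/
def TeslerCover {n : ℕ} {α : Fin n → ℕ} (B A : TeslerPoset α) : Prop :=
  (∃ i j k : Fin n, i < j ∧ j < k ∧
    A.1 + Matrix.single i k 1 = B.1 + Matrix.single i j 1 + Matrix.single j k 1) ∨
  (∃ i j : Fin n, i < j ∧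
    A.1 + Matrix.single i i 1 = B.1 + Matrix.single i j 1 + Matrix.single j j 1)

namespace TeslerPoset

/-- The sum of all entries, used to see that the order is antisymmetric. -/
def total {n : ℕ} {α : Fin n → ℕ} (A : TeslerPoset α) : ℕ := ∑ i, ∑ j, A.1 i j

theorem sum_single {n : ℕ} (a b : Fin n) :
    ∑ i, ∑ j, (Matrix.single a b 1 : Matrix (Fin n) (Fin n) ℕ) i j = 1 := by
  simp [Matrix.single_apply, ite_and]

theorem total_of_eq {n : ℕ} {α : Fin n → ℕ} {B A : TeslerPoset α} {a b c d e f : Fin n}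
    (h : A.1 + Matrix.single a b 1 = B.1 + Matrix.single c d 1 + Matrix.single e f 1) :
    A.total = B.total + 1 := by
  have h2 := congrArg (fun M : Matrix (Fin n) (Fin n) ℕ => ∑ i, ∑ j, M i j) h
  simp only [Matrix.add_apply, Finset.sum_add_distrib, sum_single] at h2
  unfold total
  omega

theorem total_of_cover {n : ℕ} {α : Fin n → ℕ} {B A : TeslerPoset α} (h : TeslerCover B A) :
    A.total = B.total + 1 := by
  rcases h with ⟨i, j, k, _, _, h⟩ | ⟨i, j, _, h⟩ <;> exact total_of_eq h

theorem total_of_reflTransGen {n : ℕ} {α : Fin n → ℕ} {B A : TeslerPoset α}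
    (h : Relation.ReflTransGen TeslerCover B A) : B = A ∨ B.total < A.total := by
  induction h with
  | refl => exact Or.inl rfl
  | tail _ h2 ih =>
    have := total_of_cover h2
    rcases ih with rfl | ih <;> right <;> omega

/-- The Tesler poset: the partial order generated by the cover relation. -/
instance {n : ℕ} (α : Fin n → ℕ) : PartialOrder (TeslerPoset α) where
  le := Relation.ReflTransGen TeslerCover
  le_refl _ := Relation.ReflTransGen.refl
  le_trans _ _ _ := Relation.ReflTransGen.trans
  le_antisymm A B h1 h2 := by
    rcases total_of_reflTransGen h1 with h | h
    · exact h
    · rcases total_of_reflTransGen h2 with h' | h'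
      · exact h'.symm
      · omega

theorem row_sum {n : ℕ} {α : Fin n → ℕ} (A : TeslerPoset α) (k : Fin n) :
    ∑ j ∈ Finset.Ici k, A.1 k j = α k + ∑ i ∈ Finset.Iio k, A.1 i k := by
  have h := A.2.2 k
  unfold hookSum at h
  zify
  linarith

theorem exists_bound {n : ℕ} (α : Fin n → ℕ) (k : Fin n) :
    ∃ c : ℕ, ∀ (A : TeslerPoset α) (j : Fin n), A.1 k j ≤ c := by
  induction k using WellFoundedLT.induction with
  | ind k ih =>
    choose! c hc using ih
    refine ⟨α k + ∑ i ∈ Finset.Iio k, c i, fun A j => ?_⟩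
    by_cases hj : j < k
    · rw [A.2.1 k j hj]; exact Nat.zero_le _
    · calc A.1 k j ≤ ∑ j ∈ Finset.Ici k, A.1 k j :=
            Finset.single_le_sum (f := fun j => A.1 k j) (fun _ _ => Nat.zero_le _)
              (Finset.mem_Ici.2 (not_lt.1 hj))
        _ = α k + ∑ i ∈ Finset.Iio k, A.1 i k := row_sum A k
        _ ≤ _ := Nat.add_le_add_left
            (Finset.sum_le_sum fun i hi => hc i (Finset.mem_Iio.1 hi) A k) _

instance {n : ℕ} (α : Fin n → ℕ) : Finite (TeslerPoset α) := by
  choose c hc using exists_bound α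
  refine Finite.of_injective
    (fun (A : TeslerPoset α) (i j : Fin n) => (⟨A.1 i j, Nat.lt_succ_of_le (hc i A j)⟩ :
      Fin (c i).succ)) fun A B h => Subtype.ext ?_
  ext i j
  exact congrArg Fin.val (congrFun (congrFun h i) j)

noncomputable instance {n : ℕ} (α : Fin n → ℕ) : Fintype (TeslerPoset α) := Fintype.ofFinite _

noncomputable instance {n : ℕ} (α : Fin n → ℕ) : DecidableEq (TeslerPoset α) :=
  Classical.decEq _

open scoped Classical in
noncomputable instance {n : ℕ} (α : Fin n → ℕ) : LocallyFiniteOrder (TeslerPoset α) :=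
  Fintype.toLocallyFiniteOrder

theorem hookSum_add {n : ℕ} (A B : Matrix (Fin n) (Fin n) ℕ) (k : Fin n) :
    hookSum (A + B) k = hookSum A k + hookSum B k := by
  simp only [hookSum, Matrix.add_apply, Nat.cast_add, Finset.sum_add_distrib]
  ring

theorem hookSum_single {n : ℕ} (a b k : Fin n) (h : a ≤ b) :
    hookSum (Matrix.single a b 1) k =
      (if a = k then 1 else 0) - (if a < b ∧ b = k then 1 else 0) := by
  have h1 : (∑ j ∈ Finset.Ici k, ((Matrix.single a b 1 : Matrix (Fin n) (Fin n) ℕ) k j : ℤ)) =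
      if a = k then 1 else 0 := by
    by_cases hk : a = k
    · subst hk
      simp [Matrix.single_apply, h]
    · simp [hk]
  have h2 : (∑ i ∈ Finset.Iio k, ((Matrix.single a b 1 : Matrix (Fin n) (Fin n) ℕ) i k : ℤ)) =
      if a < b ∧ b = k then 1 else 0 := by
    by_cases hk : b = k
    · subst hk
      simp [Matrix.single_apply]
    · simp [hk]
  rw [hookSum, h1, h2]

theorem hookSum_diagonal {n : ℕ} (α : Fin n → ℕ) (k : Fin n) :
    hookSum (Matrix.diagonal α) k = α k := by
  have h2 : (∑ i ∈ Finset.Iio k, ((Matrix.diagonal α : Matrix (Fin n) (Fin n) ℕ) i k : ℤ)) = 0 :=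
    Finset.sum_eq_zero fun i hi => by
      rw [Matrix.diagonal_apply_ne _ (ne_of_lt (Finset.mem_Iio.1 hi))]; rfl
  have h1 : (∑ j ∈ Finset.Ici k, ((Matrix.diagonal α : Matrix (Fin n) (Fin n) ℕ) k j : ℤ)) =
      α k := by
    rw [Finset.sum_eq_single k]
    · simp
    · intro j _ hj
      rw [Matrix.diagonal_apply_ne _ hj.symm]; rfl
    · simp
  rw [hookSum, h1, h2, sub_zero]

/-- The diagonal matrix with diagonal `α`, the least element of the Tesler poset. -/
def diag {n : ℕ} (α : Fin n → ℕ) : TeslerPoset α :=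
  ⟨Matrix.diagonal α, fun _ _ h => Matrix.diagonal_apply_ne _ (ne_of_gt h), hookSum_diagonal α⟩

theorem exists_cover {n : ℕ} {α : Fin n → ℕ} (A : TeslerPoset α) (hA : A ≠ diag α) :
    ∃ B : TeslerPoset α, TeslerCover B A := by
  have hoff : ∃ i j, i < j ∧ 0 < A.1 i j := by
    by_contra! hcon
    apply hA
    have hz : ∀ i j, i ≠ j → A.1 i j = 0 := fun i j hij => by
      rcases lt_or_gt_of_ne hij with h | h
      · exact Nat.le_zero.1 (hcon i j h)
      · exact A.2.1 i j h
    apply Subtype.ext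
    ext i j
    by_cases hij : i = j
    · subst hij
      have h := row_sum A i
      rw [Finset.sum_eq_single i (fun j _ hj => hz i j hj.symm) (by simp),
        Finset.sum_eq_zero fun k hk => hz k i (ne_of_lt (Finset.mem_Iio.1 hk))] at h
      simpa [diag] using h
    · rw [hz i j hij]
      exact (Matrix.diagonal_apply_ne _ hij).symm
  obtain ⟨i, j, hij, hpos⟩ := hoff
  have hrow : 0 < ∑ k ∈ Finset.Ici j, A.1 j k := by
    rw [row_sum]
    exact Nat.add_pos_right _ (Finset.sum_pos_iff.2 ⟨i, Finset.mem_Iio.2 hij, hpos⟩)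
  obtain ⟨k, hk, hjk⟩ := Finset.sum_pos_iff.1 hrow
  have hle : j ≤ k := Finset.mem_Ici.1 hk
  have key : ∀ l, i ≤ l → (∀ p, hookSum (Matrix.single i l 1) p =
        hookSum (Matrix.single i j 1) p + hookSum (Matrix.single j k 1) p) →
      ∃ B : TeslerPoset α,
        A.1 + Matrix.single i l 1 = B.1 + Matrix.single i j 1 + Matrix.single j k 1 := by
    intro l hl hh
    have heq : A.1 + Matrix.single i l 1 =
        (A.1 + Matrix.single i l 1 - (Matrix.single i j 1 + Matrix.single j k 1)) +
          Matrix.single i j 1 + Matrix.single j k 1 := by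
      ext a b
      simp only [Matrix.add_apply, Matrix.sub_apply, Matrix.single_apply]
      have hne : ¬ (i = a ∧ j = b ∧ j = a) := fun h => hij.ne (h.1.trans h.2.2.symm)
      have e1 : i = a ∧ j = b → 0 < A.1 a b := by rintro ⟨rfl, rfl⟩; exact hpos
      have e2 : j = a ∧ k = b → 0 < A.1 a b := by rintro ⟨rfl, rfl⟩; exact hjk
      split_ifs <;> grind
    refine ⟨⟨_, fun a b hab => ?_, fun p => ?_⟩, heq⟩
    · simp only [Matrix.add_apply, Matrix.sub_apply, Matrix.single_apply, A.2.1 a b hab]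
      have : ¬ (i = a ∧ l = b) := by rintro ⟨rfl, rfl⟩; exact absurd hab (not_lt.2 hl)
      simp [this]
    · have h := congrArg (fun M => hookSum M p) heq
      simp only [hookSum_add] at h
      have h1 := hh p
      have h2 := A.2.2 p
      linarith
  rcases eq_or_lt_of_le hle with rfl | hlt
  · obtain ⟨B, hB⟩ := key i le_rfl fun p => by
      rw [hookSum_single _ _ _ le_rfl, hookSum_single _ _ _ hij.le, hookSum_single _ _ _ le_rfl]
      simp [hij]
    exact ⟨B, Or.inr ⟨i, j, hij, hB⟩⟩
  · obtain ⟨B, hB⟩ := key k (hij.le.trans hle) fun p => by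
      rw [hookSum_single _ _ _ (hij.le.trans hle), hookSum_single _ _ _ hij.le,
        hookSum_single _ _ _ hle]
      simp [hij, hlt, hij.trans hlt]
    exact ⟨B, Or.inl ⟨i, j, k, hij, hlt, hB⟩⟩

instance {n : ℕ} (α : Fin n → ℕ) : OrderBot (TeslerPoset α) where
  bot := diag α
  bot_le A := by
    induction h : A.total using Nat.strong_induction_on generalizing A with
    | _ t ih =>
      by_cases hA : A = diag α
      · exact hA ▸ le_refl _
      · obtain ⟨B, hB⟩ := exists_cover A hA
        have hlt : B.total < t := by have := total_of_cover hB; omega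
        exact le_trans (ih _ hlt B rfl) (Relation.ReflTransGen.single hB)

end TeslerPoset

/-- The Möbius function of the Tesler poset. -/
noncomputable def teslerMoebius {n : ℕ} (α : Fin n → ℕ) (B A : TeslerPoset α) : ℤ :=
  IncidenceAlgebra.mu ℤ B A

/-! A Tesler matrix is an integer flow: each vertex injects one unit, off-diagonal entries are
edges, and diagonal entries drain into a sink `⊤`. Both kinds of cover then become one move: split a
unit edge `i → m` at a vertex `j` with `i < j < m`.

Choosing a set `S i` of vertices above each `i` and superposing the paths `i → S i → ⊤` gives a map
`ofSets` from `2 ^ n.choose 2` families to Tesler matrices. By `mu_bot_eq`, `|μ(⊥, A)|` is the size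
of the fibre over `A`. Each fibre thus has at most `f n` elements, and summing over `A` gives the
bound.

For the fibre formula it suffices that, for `A ≠ ⊥`, the families with `ofSets S ≤ A`, signed by
total flow, cancel (`sum_sign_ofSets_le`). Take an edge `i → j` of `A` whose source `i` has no
inflow. Toggling `j` in `S i` is a sign-reversing involution: by `split_le_of_le`, inserting `j`
never leaves the ideal below `A`. -/

namespace TeslerPoset

/-! ### Unit flows and edge splitting -/

variable {n : ℕ}

/-- The unit flow from `i` to `m`, where `⊤` is the sink: as a matrix, the flow into the sink is
recorded on the diagonal. -/
def edge (i : Fin n) : WithTop (Fin n) → Matrix (Fin n) (Fin n) ℕ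
  | ⊤ => Matrix.single i i 1
  | (j : Fin n) => Matrix.single i j 1

theorem edge_top_apply (i x y : Fin n) : edge i ⊤ x y = if i = x ∧ i = y then 1 else 0 := by
  simp only [edge, Matrix.single_apply]

theorem edge_coe_apply (i j x y : Fin n) :
    edge i (j : WithTop (Fin n)) x y = if i = x ∧ j = y then 1 else 0 := by
  simp only [edge, Matrix.single_apply]

theorem edge_apply_of_ne {i x : Fin n} (h : i ≠ x) (m : WithTop (Fin n)) (y : Fin n) :
    edge i m x y = 0 := by
  induction m using WithTop.recTopCoe <;> simp [edge_top_apply, edge_coe_apply, h]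

theorem edge_apply_of_lt {i x y : Fin n} {m : WithTop (Fin n)} (h : i < m) (hyx : y < x) :
    edge i m x y = 0 := by
  induction m using WithTop.recTopCoe with
  | top => rw [edge_top_apply, if_neg]; rintro ⟨rfl, rfl⟩; exact lt_irrefl _ hyx
  | coe m =>
    rw [edge_coe_apply, if_neg]; rintro ⟨rfl, rfl⟩; exact lt_asymm hyx (WithTop.coe_lt_coe.1 h)

theorem sum_edge (i : Fin n) (m : WithTop (Fin n)) : ∑ x, ∑ y, edge i m x y = 1 := by
  induction m using WithTop.recTopCoe <;> exact sum_single _ _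

theorem hookSum_edge {i : Fin n} {m : WithTop (Fin n)} (h : i < m) (k : Fin n) :
    hookSum (edge i m) k = (if i = k then 1 else 0) - (if m = k then 1 else 0) := by
  induction m using WithTop.recTopCoe with
  | top => simpa [edge] using hookSum_single i i k le_rfl
  | coe m =>
    have h := WithTop.coe_lt_coe.1 h
    simpa [edge, h] using hookSum_single i m k h.le

theorem cover_of_edge {α : Fin n → ℕ} {B A : TeslerPoset α} {i j : Fin n} {m : WithTop (Fin n)}
    (hij : i < j) (hjm : j < m) (h : A.1 + edge i m = B.1 + edge i j + edge j m) :
    TeslerCover B A := by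
  induction m using WithTop.recTopCoe with
  | top => exact Or.inr ⟨i, j, hij, h⟩
  | coe m => exact Or.inl ⟨i, j, m, hij, WithTop.coe_lt_coe.1 hjm, h⟩

theorem exists_edge_of_cover {α : Fin n → ℕ} {B A : TeslerPoset α} (h : TeslerCover B A) :
    ∃ (i j : Fin n) (m : WithTop (Fin n)), i < j ∧ j < m ∧
      A.1 + edge i m = B.1 + edge i j + edge j m := by
  rcases h with ⟨i, j, k, hij, hjk, h⟩ | ⟨i, j, hij, h⟩
  · exact ⟨i, j, k, hij, WithTop.coe_lt_coe.2 hjk, h⟩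
  · exact ⟨i, j, ⊤, hij, WithTop.coe_lt_top j, h⟩

/-- An edge carrying flow can be split at any intermediate vertex. -/
theorem exists_split {α : Fin n → ℕ} (B : TeslerPoset α) {i j : Fin n} {m : WithTop (Fin n)}
    (hij : i < j) (hjm : j < m) (hB : ∀ x, edge i m i x ≤ B.1 i x) :
    ∃ A : TeslerPoset α, A.1 + edge i m = B.1 + edge i j + edge j m := by
  have him : (i : WithTop (Fin n)) < m := (WithTop.coe_lt_coe.2 hij).trans hjm
  have hle : ∀ x y, edge i m x y ≤ B.1 x y := fun x y => by
    by_cases hx : i = x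
    · subst hx; exact hB y
    · rw [edge_apply_of_ne hx]; exact Nat.zero_le _
  have heq : B.1 + edge i j + edge j m - edge i m + edge i m = B.1 + edge i j + edge j m := by
    ext x y
    have := hle x y
    simp only [Matrix.add_apply, Matrix.sub_apply]
    omega
  refine ⟨⟨_, fun x y hyx => ?_, fun k => ?_⟩, heq⟩
  · have h1 := edge_apply_of_lt (WithTop.coe_lt_coe.2 hij) hyx
    have h2 := edge_apply_of_lt hjm hyx
    have h3 := B.2.1 x y hyx
    simp only [Matrix.add_apply, Matrix.sub_apply]
    omega
  · have h := congrArg (fun M => hookSum M k) heq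
    simp only [hookSum_add, hookSum_edge him, hookSum_edge (WithTop.coe_lt_coe.2 hij),
      hookSum_edge hjm, WithTop.coe_inj] at h
    have h2 := B.2.2 k
    linarith

/-- If `i` has no inflow in `A` and `A` sends the unit of flow at `i` to `j`, then everything
below `A` sends this unit to some `m ≥ j`, and remains below `A` after splitting at `j`. -/
theorem split_le_of_le {A B : TeslerPoset (fun _ : Fin n => 1)} (hBA : B ≤ A) {i j : Fin n}
    (hij : i < j) (hin : ∀ r < i, A.1 r i = 0) (hA : 0 < A.1 i j) :
    ∃ m : WithTop (Fin n), j ≤ m ∧ (∀ x, B.1 i x = edge i m i x) ∧ (∀ r < i, B.1 r i = 0) ∧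
      ∀ B' : TeslerPoset (fun _ : Fin n => 1), j < m →
        B'.1 + edge i m = B.1 + edge i j + edge j m → B' ≤ A := by
  change Relation.ReflTransGen TeslerCover B A at hBA
  induction hBA using Relation.ReflTransGen.head_induction_on with
  | refl =>
    -- Without inflow, row `i` sums to `1`, so a positive entry at `j` is the whole row.
    refine ⟨j, le_rfl, fun x => ?_, hin, fun _ h => absurd h (lt_irrefl _)⟩
    have hrow := row_sum A i
    rw [Finset.sum_eq_zero fun r hr => hin r (Finset.mem_Iio.1 hr),
      ← Finset.add_sum_erase _ _ (Finset.mem_Ici.2 hij.le)] at hrow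
    rw [edge_coe_apply]
    by_cases hx : j = x
    · subst hx; simp; omega
    · rw [if_neg (fun h => hx h.2)]
      by_cases hxi : x < i
      · exact A.2.1 i x hxi
      · have := Finset.single_le_sum (f := fun y => A.1 i y) (fun _ _ => Nat.zero_le _)
          (Finset.mem_erase.2 ⟨Ne.symm hx, Finset.mem_Ici.2 (not_lt.1 hxi)⟩)
        have hx0 : A.1 i x ≤ _ := this
        omega
  | @head B B₁ hcov hle ih =>
    obtain ⟨m, hjm, hrow, hcol, hsplit⟩ := ih
    obtain ⟨a, c, b, hac, hcb, heq⟩ := exists_edge_of_cover hcov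
    have heq' : ∀ x y, B₁.1 x y + edge a b x y = B.1 x y + edge a c x y + edge c b x y :=
      fun x y => congrFun (congrFun heq x) y
    -- If the split edge ended at `i`, then `B₁` would contain `c → i`, an inflow.
    have hbi : ∀ r < i, edge a b r i = 0 := fun r hr => by
      by_contra hne
      induction b using WithTop.recTopCoe with
      | top =>
        rw [edge_top_apply] at hne
        have : a = r ∧ a = i := by by_contra h; exact hne (if_neg h)
        omega
      | coe b =>
        rw [edge_coe_apply] at hne
        have hab : a = r ∧ b = i := by by_contra h; exact hne (if_neg h)
        obtain ⟨rfl, rfl⟩ := hab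
        have hcb := WithTop.coe_lt_coe.1 hcb
        have h1 := heq' c b
        rw [hcol c hcb, edge_apply_of_ne hac.ne, edge_apply_of_ne hac.ne, edge_coe_apply] at h1
        simp at h1
    have hci : c ≠ i := by
      rintro rfl
      have h1 := heq' a c
      rw [hcol a hac, hbi a hac, edge_coe_apply] at h1
      simp at h1
      omega
    have hcol' : ∀ r < i, B.1 r i = 0 := fun r hr => by
      have h1 := heq' r i
      rw [hcol r hr, hbi r hr] at h1
      omega
    have hB₁ : ∀ x, edge i m i x ≤ B₁.1 i x := fun x => (hrow x).ge
    by_cases hai : a = i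
    · subst hai
      have hmc : m = c := by
        by_contra hne
        have h1 := heq' a c
        rw [hrow c, edge_coe_apply] at h1
        have h2 : edge a m a c = 0 := by
          induction m using WithTop.recTopCoe with
          | top => simp [edge_top_apply, hac.ne]
          | coe m => simpa [edge_coe_apply] using hne
        have h3 : edge a b a c = 0 := by
          induction b using WithTop.recTopCoe with
          | top => simp [edge_top_apply, hac.ne]
          | coe b => simpa [edge_coe_apply] using (WithTop.coe_lt_coe.1 hcb).ne'
        simp at h1
        omega
      subst hmc
      refine ⟨b, hjm.trans hcb.le, fun x => ?_, hcol', fun B' hjb hB' => ?_⟩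
      · have h1 := heq' a x
        rw [hrow x, edge_apply_of_ne hci] at h1
        omega
      · have hB'' := fun x y => congrFun (congrFun hB' x) y
        simp only [Matrix.add_apply] at hB''
        rcases hjm.eq_or_lt with hjc | hjc
        · obtain rfl := WithTop.coe_inj.1 hjc
          have : B' = B₁ := by
            apply Subtype.ext
            ext x y
            have h1 := hB'' x y
            have h2 := heq' x y
            omega
          exact this ▸ hle
        · obtain ⟨B₂, hB₂⟩ := exists_split B₁ hij hjc hB₁
          refine le_trans ?_ (hsplit B₂ hjc hB₂)
          refine Relation.ReflTransGen.single
            (cover_of_edge (WithTop.coe_lt_coe.1 hjc) hcb ?_)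
          ext x y
          have h1 := hB'' x y
          have h2 := heq' x y
          have h3 := congrFun (congrFun hB₂ x) y
          simp only [Matrix.add_apply] at h3 ⊢
          omega
    · refine ⟨m, hjm, fun x => ?_, hcol', fun B' hjm' hB' => ?_⟩
      · have h1 := heq' i x
        rw [edge_apply_of_ne hai, edge_apply_of_ne hai, edge_apply_of_ne hci] at h1
        rw [← hrow x]
        omega
      · obtain ⟨B₂, hB₂⟩ := exists_split B₁ hij hjm' hB₁
        refine le_trans ?_ (hsplit B₂ hjm' hB₂)
        refine Relation.ReflTransGen.single (cover_of_edge hac hcb ?_)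
        ext x y
        have h1 := congrFun (congrFun hB' x) y
        have h2 := heq' x y
        have h3 := congrFun (congrFun hB₂ x) y
        simp only [Matrix.add_apply] at h1 h3 ⊢
        omega

/-! ### Superpositions of paths -/

/-- The unit flow from `i` to the sink passing through the vertices in `s`. -/
def path (i : Fin n) (s : Finset (Fin n)) : Matrix (Fin n) (Fin n) ℕ :=
  edge i s.min + ∑ a ∈ s, edge a (s.filter (a < ·)).min

theorem path_empty (i : Fin n) : path i ∅ = edge i ⊤ := by
  simp [path]

/-- A new least vertex splits the first edge of the path. Since the minimum of `∅` is `⊤`, this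
includes the edge into the sink. -/
theorem path_insert (i : Fin n) {j : Fin n} {s : Finset (Fin n)} (hj : ∀ a ∈ s, j < a) :
    path i (insert j s) + edge i s.min = path i s + edge i j + edge j s.min := by
  have hjs : j ∉ s := fun h => lt_irrefl _ (hj j h)
  have h1 : (insert j s).min = j := by
    rw [Finset.min_insert]
    refine min_eq_left (Finset.le_min fun a ha => WithTop.coe_le_coe.2 (hj a ha).le)
  have h2 : (insert j s).filter (j < ·) = s := by
    rw [Finset.filter_insert, if_neg (lt_irrefl j), Finset.filter_true_of_mem hj]
  have h3 : ∑ a ∈ s, edge a ((insert j s).filter (a < ·)).min =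
      ∑ a ∈ s, edge a (s.filter (a < ·)).min :=
    Finset.sum_congr rfl fun a ha => by rw [Finset.filter_insert, if_neg (hj a ha).not_gt]
  rw [path, path, Finset.sum_insert hjs, h1, h2, h3]
  abel

theorem lt_min_of_forall_lt {i : Fin n} {s : Finset (Fin n)} (h : ∀ a ∈ s, i < a) :
    (i : WithTop (Fin n)) < s.min := by
  rcases s.eq_empty_or_nonempty with rfl | hs
  · simp
  · obtain ⟨a, ha⟩ := Finset.min_of_nonempty hs
    rw [ha]
    exact WithTop.coe_lt_coe.2 (h a (Finset.mem_of_min ha))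

theorem path_spec (i : Fin n) (s : Finset (Fin n)) (hs : ∀ a ∈ s, i < a) :
    (∀ x y, y < x → path i s x y = 0) ∧ (∀ k, hookSum (path i s) k = if i = k then 1 else 0) ∧
      ∑ x, ∑ y, path i s x y = 1 + s.card := by
  induction s using Finset.induction_on_min with
  | empty =>
    rw [path_empty]
    refine ⟨fun x y h => edge_apply_of_lt (WithTop.coe_lt_top i) h, fun k => ?_, ?_⟩
    · rw [hookSum_edge (WithTop.coe_lt_top i)]; simp
    · rw [sum_edge]; simp
  | insert j s hj ih =>
    have his : ∀ a ∈ s, i < a := fun a ha => hs a (Finset.mem_insert_of_mem ha)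
    have hij : i < j := hs j (Finset.mem_insert_self _ _)
    have him := lt_min_of_forall_lt his
    have hjm := lt_min_of_forall_lt hj
    have hjs : j ∉ s := fun h => lt_irrefl _ (hj j h)
    obtain ⟨h1, h2, h3⟩ := ih his
    have h := path_insert i hj
    refine ⟨fun x y hyx => ?_, fun k => ?_, ?_⟩
    · have h' := congrFun (congrFun h x) y
      simp only [Matrix.add_apply, h1 x y hyx, edge_apply_of_lt him hyx,
        edge_apply_of_lt (WithTop.coe_lt_coe.2 hij) hyx, edge_apply_of_lt hjm hyx] at h'
      omega
    · have h' := congrArg (fun M => hookSum M k) h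
      simp only [hookSum_add, h2, hookSum_edge him, hookSum_edge (WithTop.coe_lt_coe.2 hij),
        hookSum_edge hjm, WithTop.coe_inj] at h'
      linarith
    · have h' := congrArg (fun M : Matrix (Fin n) (Fin n) ℕ => ∑ x, ∑ y, M x y) h
      simp only [Matrix.add_apply, Finset.sum_add_distrib, sum_edge, h3] at h'
      rw [Finset.card_insert_of_notMem hjs]
      omega

theorem path_apply_self {i : Fin n} {s : Finset (Fin n)} (hs : ∀ a ∈ s, i < a) (x : Fin n) :
    path i s i x = edge i s.min i x := by
  rw [path, Matrix.add_apply, Matrix.sum_apply,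
    Finset.sum_eq_zero fun a ha => edge_apply_of_ne (hs a ha).ne' _ _, add_zero]

theorem hookSum_sum {ι : Type*} (s : Finset ι) (M : ι → Matrix (Fin n) (Fin n) ℕ) (k : Fin n) :
    hookSum (∑ i ∈ s, M i) k = ∑ i ∈ s, hookSum (M i) k := by
  classical
  induction s using Finset.induction_on with
  | empty => simp [hookSum]
  | insert a s ha ih => rw [Finset.sum_insert ha, Finset.sum_insert ha, hookSum_add, ih]

/-- The Tesler matrix superposing, for every `i`, the path through the elements of `S i`
above `i`. -/
def ofSets (S : Fin n → Finset (Fin n)) : TeslerPoset (fun _ : Fin n => 1) :=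
  ⟨∑ i, path i ((S i).filter (i < ·)), fun x y hyx => by
    rw [Matrix.sum_apply]
    exact Finset.sum_eq_zero fun i _ => (path_spec i _ (by simp)).1 x y hyx, fun k => by
    rw [hookSum_sum, Finset.sum_congr rfl fun i _ => (path_spec i _ (by simp)).2.1 k]
    simp⟩

/-- The families of sets with `S i` consisting of elements above `i`. -/
def setFamilies (n : ℕ) : Finset (Fin n → Finset (Fin n)) :=
  Fintype.piFinset fun i => (Finset.Ioi i).powerset

theorem mem_setFamilies {S : Fin n → Finset (Fin n)} :
    S ∈ setFamilies n ↔ ∀ i, ∀ a ∈ S i, i < a := by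
  simp [setFamilies, Finset.subset_iff]

theorem card_setFamilies (n : ℕ) : (setFamilies n).card = 2 ^ n.choose 2 := by
  rw [setFamilies, Fintype.card_piFinset]
  simp only [Finset.card_powerset, Fin.card_Ioi]
  rw [Finset.prod_pow_eq_pow_sum, Fin.sum_univ_eq_sum_range (fun i => n - 1 - i),
    Finset.sum_range_reflect (fun i => i), Finset.sum_range_id, Nat.choose_two_right]

/-- The filter only makes `ofSets` defined on all families; it is vacuous here. -/
theorem ofSets_val {S : Fin n → Finset (Fin n)} (hS : S ∈ setFamilies n) :
    (ofSets S).1 = ∑ i, path i (S i) := by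
  change ∑ i, path i ((S i).filter (i < ·)) = _
  exact Finset.sum_congr rfl fun i _ => by
    rw [Finset.filter_true_of_mem (mem_setFamilies.1 hS i)]

theorem total_ofSets {S : Fin n → Finset (Fin n)} (hS : S ∈ setFamilies n) :
    (ofSets S).total = n + ∑ i, (S i).card := by
  unfold total
  rw [ofSets_val hS]
  simp only [Matrix.sum_apply]
  calc _ = ∑ i, ∑ x, ∑ y, path i (S i) x y := by
        exact (Finset.sum_congr rfl fun x _ => Finset.sum_comm).trans Finset.sum_comm
    _ = ∑ i, (1 + (S i).card) :=
        Finset.sum_congr rfl fun i _ => (path_spec i _ (mem_setFamilies.1 hS i)).2.2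
    _ = _ := by simp [Finset.sum_add_distrib]

theorem ofSets_update_insert {S : Fin n → Finset (Fin n)} (hS : S ∈ setFamilies n) {i j : Fin n}
    (hij : i < j) (hj : ∀ a ∈ S i, j < a) :
    Function.update S i (insert j (S i)) ∈ setFamilies n ∧
    (ofSets (Function.update S i (insert j (S i)))).1 + edge i (S i).min =
      (ofSets S).1 + edge i j + edge j (S i).min := by
  have hmem : Function.update S i (insert j (S i)) ∈ setFamilies n := by
    refine mem_setFamilies.2 fun k a ha => ?_
    by_cases hk : k = i
    · subst hk
      rw [Function.update_self] at ha
      rcases Finset.mem_insert.1 ha with rfl | ha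
      · exact hij
      · exact mem_setFamilies.1 hS _ a ha
    · rw [Function.update_of_ne hk] at ha
      exact mem_setFamilies.1 hS _ a ha
  refine ⟨hmem, ?_⟩
  rw [ofSets_val hmem, ofSets_val hS, ← Finset.add_sum_erase _ _ (Finset.mem_univ i),
    ← Finset.add_sum_erase (a := i) Finset.univ (fun i => path i (S i)) (Finset.mem_univ i),
    Function.update_self,
    Finset.sum_congr rfl fun k hk => by rw [Function.update_of_ne (Finset.ne_of_mem_erase hk)]]
  rw [add_right_comm, path_insert i hj]
  abel

theorem ofSets_row {S : Fin n → Finset (Fin n)} (hS : S ∈ setFamilies n) (i x : Fin n) :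
    edge i (S i).min i x ≤ (ofSets S).1 i x := by
  rw [ofSets_val hS, Matrix.sum_apply, ← path_apply_self (mem_setFamilies.1 hS i)]
  exact Finset.single_le_sum (f := fun k => path k (S k) i x) (fun _ _ => Nat.zero_le _)
    (Finset.mem_univ i)

theorem edge_injective {i : Fin n} {m m' : WithTop (Fin n)} (hm : i < m) (hm' : i < m')
    (h : ∀ x, edge i m i x ≤ edge i m' i x) : m = m' := by
  induction m using WithTop.recTopCoe with
  | top =>
    induction m' using WithTop.recTopCoe with
    | top => rfl
    | coe m' =>
      have := h i
      simp [edge_top_apply, edge_coe_apply] at this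
      exact absurd (WithTop.coe_lt_coe.1 hm') (by grind)
  | coe m =>
    have hm := WithTop.coe_lt_coe.1 hm
    have := h m
    induction m' using WithTop.recTopCoe with
    | top =>
      simp [edge_top_apply, edge_coe_apply] at this
      grind
    | coe m' =>
      simp [edge_coe_apply] at this
      grind

/-! ### The sign-reversing involution and the Möbius function -/

theorem le_of_mem_of_ofSets_le {A : TeslerPoset (fun _ : Fin n => 1)} {i j : Fin n}
    (hij : i < j) (hin : ∀ r < i, A.1 r i = 0) (hA : 0 < A.1 i j)
    {S : Fin n → Finset (Fin n)} (hS : S ∈ setFamilies n) (hle : ofSets S ≤ A) :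
    (∀ a ∈ S i, j ≤ a) ∧ (j ∉ S i → ofSets (Function.update S i (insert j (S i))) ≤ A) := by
  obtain ⟨m, hjm, hrow, -, hsplit⟩ := split_le_of_le hle hij hin hA
  -- Row `i` is a single unit at `m`, and it contains the first edge of the path from `i`.
  have hmin : (S i).min = m := edge_injective (lt_min_of_forall_lt (mem_setFamilies.1 hS i))
    ((WithTop.coe_lt_coe.2 hij).trans_le hjm) fun x => (ofSets_row hS i x).trans (hrow x).le
  subst hmin
  have hj : ∀ a ∈ S i, j ≤ a := fun a ha => WithTop.coe_le_coe.1 (hjm.trans (Finset.min_le ha))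
  refine ⟨hj, fun hjS => ?_⟩
  have hj' : ∀ a ∈ S i, j < a := fun a ha =>
    lt_of_le_of_ne (hj a ha) fun h => hjS (h ▸ ha)
  exact hsplit _ (lt_min_of_forall_lt hj') (ofSets_update_insert hS hij hj').2

theorem ofSets_empty : ofSets (fun _ : Fin n => ∅) = ⊥ := by
  apply Subtype.ext
  change ∑ i, path i _ = Matrix.diagonal fun _ => 1
  ext x y
  simp [path_empty, Matrix.sum_apply, edge_top_apply, Matrix.diagonal_apply, ite_and]

/-- The first off-diagonal entry sits in a row without inflow. -/
theorem exists_source {A : TeslerPoset (fun _ : Fin n => 1)} (hA : A ≠ ⊥) :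
    ∃ i j, i < j ∧ (∀ r < i, A.1 r i = 0) ∧ 0 < A.1 i j := by
  have hoff : ∃ i, ∃ j, i < j ∧ 0 < A.1 i j := by
    by_contra! hcon
    obtain ⟨B, hB⟩ := exists_cover A hA
    obtain ⟨a, c, b, hac, hcb, heq⟩ := exists_edge_of_cover hB
    have h := congrFun (congrFun heq a) c
    have h1 := hcon a c hac
    have h2 : edge a b a c = 0 := by
      induction b using WithTop.recTopCoe with
      | top => simp [edge_top_apply, hac.ne]
      | coe b => simpa [edge_coe_apply] using (WithTop.coe_lt_coe.1 hcb).ne'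
    simp only [Matrix.add_apply, edge_coe_apply, h2] at h
    simp at h
    omega
  -- An inflow `r → i` would make `r` a smaller row with an off-diagonal entry.
  obtain ⟨i, ⟨j, hij, hpos⟩, hmin⟩ := WellFounded.has_min wellFounded_lt
    {i | ∃ j, i < j ∧ 0 < A.1 i j} hoff
  exact ⟨i, j, hij, fun r hr => by
    by_contra h
    exact hmin r ⟨i, hr, Nat.pos_of_ne_zero h⟩ hr, hpos⟩

open scoped Classical in
theorem sum_sign_ofSets_le (A : TeslerPoset (fun _ : Fin n => 1)) :
    ∑ S ∈ (setFamilies n).filter (ofSets · ≤ A), (-1 : ℤ) ^ (ofSets S).total =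
      if A = ⊥ then (-1) ^ n else 0 := by
  split_ifs with hA
  · subst hA
    have h : (setFamilies n).filter (ofSets · ≤ ⊥) = {fun _ => ∅} := by
      ext S
      simp only [Finset.mem_filter, Finset.mem_singleton, le_bot_iff]
      constructor
      · rintro ⟨hS, h⟩
        have h1 := total_ofSets hS
        rw [h, ← ofSets_empty, total_ofSets (mem_setFamilies.2 (by simp))] at h1
        funext i
        have h2 : ∑ i, (S i).card = 0 := by simpa using h1
        exact Finset.card_eq_zero.1 (Finset.sum_eq_zero_iff.1 h2 i (Finset.mem_univ i))
      · rintro rfl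
        exact ⟨mem_setFamilies.2 (by simp), ofSets_empty⟩
    rw [h, Finset.sum_singleton, total_ofSets (mem_setFamilies.2 (by simp))]
    simp
  · obtain ⟨i, j, hij, hin, hpos⟩ := exists_source hA
    have key := fun {S} (hS : S ∈ (setFamilies n).filter (ofSets · ≤ A)) =>
      le_of_mem_of_ofSets_le hij hin hpos (Finset.mem_filter.1 hS).1 (Finset.mem_filter.1 hS).2
    -- Since `j` bounds `S i` below, toggling it moves along one cover, changing the total by one.
    let σ : (Fin n → Finset (Fin n)) → Fin n → Finset (Fin n) := fun S =>
      Function.update S i (if j ∈ S i then (S i).erase j else insert j (S i))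
    have hcov : ∀ {S}, S ∈ setFamilies n → (∀ a ∈ S i, j < a) →
        TeslerCover (ofSets S) (ofSets (Function.update S i (insert j (S i)))) := fun hS hj =>
      cover_of_edge hij (lt_min_of_forall_lt hj) (ofSets_update_insert hS hij hj).2
    have hspec : ∀ S ∈ (setFamilies n).filter (ofSets · ≤ A),
        σ S ∈ (setFamilies n).filter (ofSets · ≤ A) ∧
          (TeslerCover (ofSets S) (ofSets (σ S)) ∨ TeslerCover (ofSets (σ S)) (ofSets S)) := by
      intro S hS
      obtain ⟨hj, hins⟩ := key hS
      obtain ⟨hSD, hle⟩ := Finset.mem_filter.1 hS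
      by_cases hjS : j ∈ S i
      · have hσ : σ S = Function.update S i ((S i).erase j) := by simp [σ, hjS]
        have hback : Function.update (σ S) i (insert j (σ S i)) = S := by
          simp [hσ, Finset.insert_erase hjS]
        have hσD : σ S ∈ setFamilies n := by
          refine mem_setFamilies.2 fun k a ha => mem_setFamilies.1 hSD k a ?_
          rw [hσ] at ha
          by_cases hk : k = i
          · subst hk
            rw [Function.update_self] at ha
            exact Finset.mem_of_mem_erase ha
          · rwa [Function.update_of_ne hk] at ha
        have hc := hcov hσD fun a ha => by
          rw [hσ, Function.update_self] at ha
          exact lt_of_le_of_ne (hj a (Finset.mem_of_mem_erase ha))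
            (Finset.ne_of_mem_erase ha).symm
        rw [hback] at hc
        exact ⟨Finset.mem_filter.2 ⟨hσD, (Relation.ReflTransGen.single hc).trans hle⟩, Or.inr hc⟩
      · have hσ : σ S = Function.update S i (insert j (S i)) := by simp [σ, hjS]
        have hj' : ∀ a ∈ S i, j < a := fun a ha =>
          lt_of_le_of_ne (hj a ha) fun h => hjS (h ▸ ha)
        rw [hσ]
        exact ⟨Finset.mem_filter.2 ⟨(ofSets_update_insert hSD hij hj').1, hins hjS⟩,
          Or.inl (hcov hSD hj')⟩
    refine Finset.sum_involution (fun S _ => σ S) (fun S hS => ?_) (fun S hS _ h => ?_)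
      (fun S hS => (hspec S hS).1) (fun S hS => ?_)
    · rcases (hspec S hS).2 with h | h <;> rw [total_of_cover h, pow_succ] <;> ring
    · have h2 := (hspec S hS).2
      rw [h] at h2
      rcases h2 with h2 | h2 <;> exact absurd (total_of_cover h2) (by omega)
    · by_cases hjS : j ∈ S i
      · simp [σ, hjS, Finset.insert_erase hjS]
      · simp [σ, hjS, Finset.erase_insert hjS]

/-- The Möbius function at `(⊥, A)` counts, up to sign, the set families mapped to `A`. -/
theorem mu_bot_eq (A : TeslerPoset (fun _ : Fin n => 1)) :
    IncidenceAlgebra.mu ℤ ⊥ A =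
      (-1) ^ (n + A.total) * ((setFamilies n).filter (ofSets · = A)).card := by
  classical
  induction A using WellFoundedLT.induction with
  | ind A ih =>
    let g : TeslerPoset (fun _ : Fin n => 1) → ℤ := fun B =>
      (-1) ^ (n + B.total) * ((setFamilies n).filter (ofSets · = B)).card
    have hg : ∑ B ∈ Finset.Icc ⊥ A, g B = if ⊥ = A then 1 else 0 := by
      have h1 : ∀ B ∈ Finset.Icc ⊥ A, g B = (-1 : ℤ) ^ n *
          ∑ S ∈ (setFamilies n).filter (ofSets · ≤ A) with ofSets S = B,
            (-1 : ℤ) ^ (ofSets S).total := by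
        intro B hB
        have hBA := (Finset.mem_Icc.1 hB).2
        rw [Finset.filter_filter, Finset.filter_congr (q := (ofSets · = B)) (fun S _ =>
            ⟨fun h => h.2, fun h => ⟨h.trans_le hBA, h⟩⟩), Finset.sum_congr rfl
            (g := fun _ => (-1 : ℤ) ^ B.total) fun S hS => by rw [(Finset.mem_filter.1 hS).2]]
        simp only [g, Finset.sum_const, nsmul_eq_mul, pow_add]
        ring
      rw [Finset.sum_congr rfl h1, ← Finset.mul_sum, Finset.sum_fiberwise_of_maps_to
        fun S hS => Finset.mem_Icc.2 ⟨bot_le, (Finset.mem_filter.1 hS).2⟩, sum_sign_ofSets_le]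
      simp only [eq_comm (a := A)]
      split_ifs
      · rw [← mul_pow]; simp
      · simp
    -- `μ(⊥, ·)` and `g` have equal sums over `[⊥, A]` and agree strictly below `A`, hence also at
    -- `A`.
    have hmu := IncidenceAlgebra.sum_Icc_mu_right (𝕜 := ℤ) (⊥ : TeslerPoset (fun _ : Fin n => 1)) A
    rw [← hg, ← Finset.Ico_insert_right bot_le, Finset.sum_insert Finset.right_notMem_Ico,
      Finset.sum_insert Finset.right_notMem_Ico,
      Finset.sum_congr rfl fun B hB => ih B (Finset.mem_Ico.1 hB).2] at hmu
    exact add_right_cancel hmu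

end TeslerPoset

theorem mainTheorem9 (f : ℕ → ℝ) (n : ℕ)
    (hf : ∀ A : TeslerPoset (fun _ : Fin n => 1),
      |(teslerMoebius (fun _ : Fin n => 1) ⊥ A : ℝ)| ≤ f n) :
    (teslerNumber (fun _ : Fin n => 1) : ℝ) ≥ 2 ^ (n.choose 2) / f n := by
  classical
  -- `μ(⊥, ⊥) = 1` forces `f n ≥ 1`.
  have hpos : 0 < f n := by
    refine lt_of_lt_of_le ?_ (hf ⊥)
    simp [teslerMoebius]
  have hcard : (Fintype.card (TeslerPoset (fun _ : Fin n => 1)) : ℝ) =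
      teslerNumber (fun _ : Fin n => 1) := by
    rw [← Nat.card_eq_fintype_card]; rfl
  have habs : ∀ A : TeslerPoset (fun _ : Fin n => 1),
      (((TeslerPoset.setFamilies n).filter (TeslerPoset.ofSets · = A)).card : ℝ) ≤ f n := by
    intro A
    refine le_trans (le_of_eq ?_) (hf A)
    rw [teslerMoebius, TeslerPoset.mu_bot_eq]
    simp [abs_mul]
  rw [ge_iff_le, div_le_iff₀ hpos]
  calc (2 : ℝ) ^ n.choose 2 = ((TeslerPoset.setFamilies n).card : ℝ) := by
        rw [TeslerPoset.card_setFamilies]; norm_num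
    _ = ∑ A : TeslerPoset (fun _ : Fin n => 1),
        (((TeslerPoset.setFamilies n).filter (TeslerPoset.ofSets · = A)).card : ℝ) := by
        rw [Finset.card_eq_sum_card_fiberwise (t := Finset.univ) (f := TeslerPoset.ofSets)
          fun _ _ => Finset.mem_coe.2 (Finset.mem_univ _)]
        push_cast
        rfl
    _ ≤ ∑ _A : TeslerPoset (fun _ : Fin n => 1), f n := Finset.sum_le_sum fun A _ => habs A
    _ = _ := by rw [Finset.sum_const, Finset.card_univ, nsmul_eq_mul, hcard]
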